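/- Let $n\ge 2$, $k=n-1$, and let $R(T)=\mathbb{Z}[e^{\pm a_1},\dots,e^{\pm a_n}]/(e^{a_1+\cdots+a_n}-1)$; indices of the $a_i$ are read modulo $n$ (so $a_0=a_n$). Let $R(T)^\Delta$ be the localization of $R(T)$ by the elements $1-e^{a_i-a_j}$ $(i\not\equiv j)$. Put $b_i=1-e^{-a_i}$ and $\Omega(b_i|y)=\prod_{j\ge1}(1-b_iy_j)^{-1}$, a formal power series in $y=(y_1,y_2,\dots)$. For $i\in\mathbb{Z}/n\mathbb{Z}$ let $\alpha_i=a_i-a_{i+1}$ and let $s_i$ act on power series in $y$ over $R(T)^\Delta$ by exchanging $a_i$ and $a_{i+1}$ in the coefficients, followed for $i=0$ by multiplication by $\Omega(b_1|y)/\Omega(b_n|y)$; put $T_i=(1-e^{\alpha_i})^{-1}(s_i-1)$. For a $k$-bounded partition $\lambda$ (i.e. $\lambda_1\le k$) the (non-closed) $K$-theoretic double $k$-Schur function is $$g^{(k)}_\lambda(y|b)=T_{x_\lambda}(1),\qquad x_\lambda=\cdots(s_{\lambda_2-2}\cdots s_0s_{-1})(s_{\lambda_1-1}\cdots s_1s_0),$$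 where $T_{x_\lambda}$ is the composition of the $T_i$ along this (reduced) word, which reads the residues $\mathrm{res}(i,j)=j-i \bmod n$ of the boxes of $\lambda$ from the bottom row to the top row and from right to left in each row. Define power series $z_{ij}$ for $i,j\in\mathbb{Z}$, $j-i<n$, by $z_{ij}=0$ for $i>j$, $z_{ii}=\Omega(b_i|y)$ and $(b_i-b_j)z_{ij}=z_{i,j-1}-z_{i+1,j}$ for $i<j$ (indices of $b$ modulo $n$), and let $(ZA)_{ij}=e^{-a_j}z_{ij}-z_{i,j-1}$; this is the product of $Z=(z_{ij})$ with the bidiagonal matrix $A$, $A_{jj}=e^{-a_j}$, $A_{j,j+1}=-1$. Let $\lambda$ be $k$-small, i.e. $k$-bounded with $\lambda_1+\ell(\lambda)\le n$, let $\lambda'$ be its conjugate, and put $r=\lambda_1$, $l=n-\lambda'_1+1$. For $1\le p\le r$ and $m\ge0$ let $f_m^{\langle m,p\rangle;\lambda}=h_m\big(e^{-a_{\mathrm{res}(s,p)}} \mid m\le s\le\lambda'_p\big)$ with $h_m$ the complete homogeneous symmetric polynomial ($h_0=1$, and $h_m$ of no variables is $0$ for $m>0$). Let $W_\lambda$ be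 the $r\times(\lambda'_1+r)$ matrix with columns numbered $l,\dots,n+r$ whose $p$-th row has the entry $(-1)^m f_m^{\langle m,p\rangle;\lambda}$ in column $n+p-m$ for $m\ge0$, and $0$ in the columns to the right of $n+p$. Let $$N_\lambda=\begin{pmatrix}(ZA)_{[l,n]}^{[l,n+r]}\\ W_\lambda\end{pmatrix},\qquad \xi_\lambda(y)=\prod_{i=1}^{\lambda'_1}\Omega(b_{\mathrm{res}(i,1)}|y),$$ where $(ZA)_{[l,n]}^{[l,n+r]}$ is the block with rows $l,\dots,n$ and columns $l,\dots,n+r$. For a box $x=(i,i)$ on the main diagonal $\mathrm{diag}(\lambda)$ let $r(x)$ be the residue of the rightmost box in the row of $x$ and $b(x)$ the residue of the bottom box in the column of $x$. Then $$g^{(k)}_\lambda(y|b)=e^{\sum_{x\in\mathrm{diag}(\lambda)}(a_{r(x)+1}-a_{b(x)})}\;e^{\sum_{i=1}^{\lambda'_1}a_{\mathrm{res}(i,1)}}\;\frac{\det(N_\lambda)}{\xi_\lambda(y)} .$$ -/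

import Mathlib

noncomputable section

namespace KSchur

/-! Residues modulo `n` are elements of `ZMod n`; in the list `a_1, ..., a_n`
the index `n` is the residue `0`. -/

/-- The weight lattice of the maximal torus `T` of `SL_n`: the lattice `ℤ a_1 ⊕ ... ⊕ ℤ a_n`
modulo `ℤ (a_1 + ... + a_n)`. -/
abbrev Weight (n : ℕ) : Type :=
  (ZMod n → ℤ) ⧸ AddSubgroup.zmultiples (1 : ZMod n → ℤ)

/-- The weight `a_i`. -/
def a {n : ℕ} (i : ZMod n) : Weight n :=
  QuotientAddGroup.mk (Pi.single i 1)

/-- The representation ring `R(T) = ℤ[e^{± a_1}, ..., e^{± a_n}] / (e^{a_1 + ... + a_n} - 1)`,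
i.e. the group ring of the weight lattice. -/
abbrev RT (n : ℕ) : Type := AddMonoidAlgebra ℤ (Weight n)

/-- `e^μ` in `R(T)`. -/
def expRT {n : ℕ} (μ : Weight n) : RT n := AddMonoidAlgebra.single μ 1

/-- The multiplicative set generated by the `1 - e^{a_i - a_j}`, `i ≠ j`. -/
def rootMonoid (n : ℕ) : Submonoid (RT n) :=
  Submonoid.closure {x | ∃ i j : ZMod n, i ≠ j ∧ x = 1 - expRT (a i - a j)}

/-- The localization `R(T)^Δ` of `R(T)` by the multiplicative set generated by the
`1 - e^{a_i - a_j}`, `i ≠ j`. -/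
def RTΔ (n : ℕ) : Type := Localization (rootMonoid n)

instance (n : ℕ) : CommRing (RTΔ n) := inferInstanceAs (CommRing (Localization (rootMonoid n)))

instance (n : ℕ) : Algebra (RT n) (RTΔ n) :=
  inferInstanceAs (Algebra (RT n) (Localization (rootMonoid n)))

instance (n : ℕ) : IsLocalization (rootMonoid n) (RTΔ n) :=
  inferInstanceAs (IsLocalization (rootMonoid n) (Localization (rootMonoid n)))

/-- `e^μ` in `R(T)^Δ`. -/
def ex {n : ℕ} (μ : Weight n) : RTΔ n := algebraMap (RT n) (RTΔ n) (expRT μ)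

/-- The action of a permutation `s` of the indices on weights, `a_i ↦ a_{s i}`. -/
def permWeight {n : ℕ} (s : Equiv.Perm (ZMod n)) : Weight n →+ Weight n :=
  QuotientAddGroup.map _ _
    ((LinearMap.funLeft ℤ ℤ (s.symm : ZMod n → ZMod n)).toAddMonoidHom)
    (by
      rw [AddSubgroup.zmultiples_le]
      exact AddSubgroup.mem_zmultiples (1 : ZMod n → ℤ))

theorem permWeight_a {n : ℕ} (s : Equiv.Perm (ZMod n)) (i : ZMod n) :
    permWeight s (a i) = a (s i) := by
  unfold permWeight a
  rw [QuotientAddGroup.map_mk]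
  congr 1
  funext j
  simp only [LinearMap.toAddMonoidHom_coe, LinearMap.funLeft_apply, Pi.single_apply,
    Equiv.symm_apply_eq]

/-- The action of a permutation of the indices on `R(T)`. -/
def permRT {n : ℕ} (s : Equiv.Perm (ZMod n)) : RT n →+* RT n :=
  AddMonoidAlgebra.mapDomainRingHom ℤ (permWeight s)

theorem permRT_expRT {n : ℕ} (s : Equiv.Perm (ZMod n)) (μ : Weight n) :
    permRT s (expRT μ) = expRT (permWeight s μ) := by
  simp [permRT, expRT]

theorem rootMonoid_le_comap {n : ℕ} (s : Equiv.Perm (ZMod n)) :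
    rootMonoid n ≤ (rootMonoid n).comap (permRT s) := by
  refine Submonoid.closure_le.2 ?_
  rintro x ⟨i, j, hij, rfl⟩
  refine Submonoid.subset_closure ⟨s i, s j, fun h => hij (s.injective h), ?_⟩
  simp [permRT_expRT, permWeight_a]

/-- The action of a permutation of the indices on `R(T)^Δ`. -/
def permRTΔ {n : ℕ} (s : Equiv.Perm (ZMod n)) : RTΔ n →+* RTΔ n :=
  IsLocalization.map (RTΔ n) (permRT s) (rootMonoid_le_comap s)

theorem permRTΔ_ex {n : ℕ} (s : Equiv.Perm (ZMod n)) (μ : Weight n) :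
    permRTΔ s (ex μ) = ex (permWeight s μ) := by
  unfold permRTΔ ex
  rw [IsLocalization.map_eq, permRT_expRT]

/-- Formal power series in infinitely many variables `y_1, y_2, ...` (indexed by `ℕ`) with
coefficients in `R(T)^Δ`. It contains the ring of symmetric formal power series with
coefficients in `R(T)`. -/
abbrev Series (n : ℕ) : Type := MvPowerSeries ℕ (RTΔ n)

/-- Constants in the ring of power series. -/
abbrev cst {n : ℕ} (c : RTΔ n) : Series n := MvPowerSeries.C c

/-- `b_i = 1 - e^{-a_i}`. -/
def b {n : ℕ} (i : ZMod n) : RTΔ n := 1 - ex (-a i)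

/-- `∏_j (1 - c y_j)⁻¹ = ∏_j ∑_m c^m y_j^m`: the coefficient of every monomial of total
degree `d` is `c^d`. -/
def cauchy {n : ℕ} (c : RTΔ n) : Series n := fun m => c ^ m.degree

theorem constantCoeff_cauchy {n : ℕ} (c : RTΔ n) :
    MvPowerSeries.constantCoeff (cauchy c) = ((1 : (RTΔ n)ˣ) : RTΔ n) := by
  rw [← MvPowerSeries.coeff_zero_eq_constantCoeff_apply]
  change c ^ (Finsupp.degree (0 : ℕ →₀ ℕ)) = _
  simp

/-- `Ω(b_i | y) = ∏_j (1 - b_i y_j)⁻¹`, as an invertible power series. -/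
def Ω {n : ℕ} (i : ZMod n) : (Series n)ˣ where
  val := cauchy (b i)
  inv := MvPowerSeries.invOfUnit (cauchy (b i)) 1
  val_inv := MvPowerSeries.mul_invOfUnit _ _ (constantCoeff_cauchy _)
  inv_val := by
    rw [mul_comm]
    exact MvPowerSeries.mul_invOfUnit _ _ (constantCoeff_cauchy _)

/-- The action of the simple reflections on power series. The (level zero) action on coefficients
exchanges `a_i` and `a_{i+1}`; for `i = 0` this is `s_θ`, which exchanges `a_n` and `a_1`,
and `s_0(f) = Ω(b_1|y) / Ω(b_n|y) * s_θ(f)`. -/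
def simpleReflection {n : ℕ} (i : ZMod n) (f : Series n) : Series n :=
  (if i = 0 then ((Ω (1 : ZMod n) / Ω (0 : ZMod n) : (Series n)ˣ) : Series n) else 1) *
    MvPowerSeries.map (permRTΔ (Equiv.swap i (i + 1))) f

/-- The simple root `α_i = a_i - a_{i+1}`; in particular `α_0 = a_n - a_1 = -θ`. -/
def α {n : ℕ} (i : ZMod n) : Weight n := a i - a (i + 1)

/-- The elements `1 - e^{a_i - a_j}`, `i ≠ j`, are invertible in `R(T)^Δ`, so that `Ring.inverse`
is the true inverse of them. -/
theorem isUnit_one_sub_ex {n : ℕ} {i j : ZMod n} (h : i ≠ j) :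
    IsUnit (1 - ex (a i - a j) : RTΔ n) := by
  have := IsLocalization.map_units (RTΔ n)
    (⟨1 - expRT (a i - a j), Submonoid.subset_closure ⟨i, j, h, rfl⟩⟩ : rootMonoid n)
  simpa [ex] using this

theorem ex_add {n : ℕ} (μ ν : Weight n) : ex (μ + ν) = ex μ * ex ν := by
  simp [ex, expRT, ← map_mul, AddMonoidAlgebra.single_mul_single]

theorem ex_zero {n : ℕ} : ex (0 : Weight n) = 1 := by
  rw [ex, expRT, ← AddMonoidAlgebra.one_def, map_one]

theorem isUnit_b_sub_b {n : ℕ} {i j : ZMod n} (h : i ≠ j) : IsUnit (b i - b j : RTΔ n) := by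
  have h1 : (b i - b j : RTΔ n) = ex (-a j) * (1 - ex (a j - a i)) := by
    rw [mul_sub, ← ex_add]
    simp [b, sub_eq_add_neg]
    ring
  rw [h1]
  refine IsUnit.mul (IsUnit.of_mul_eq_one (ex (a j)) ?_) (isUnit_one_sub_ex h.symm)
  rw [← ex_add, neg_add_cancel, ex_zero]

/-- The Demazure operator `T_i = (1 - e^{α_i})⁻¹ (s_i - 1)`. -/
def T {n : ℕ} (i : ZMod n) (f : Series n) : Series n :=
  cst (Ring.inverse (1 - ex (α i))) * (simpleReflection i f - f)

/-- The operator `T_{i_1} ∘ ... ∘ T_{i_m}` attached to the word `s_{i_1} ... s_{i_m}`. -/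
def Tword {n : ℕ} (w : List (ZMod n)) (f : Series n) : Series n :=
  w.foldr T f

/-! Partitions are Young diagrams; Mathlib numbers rows and columns from `0`, so
`lam.rowLen i` is `λ_{i+1}` and `lam.colLen j` is `λ'_{j+1}`. -/

/-- A partition is `k`-small (`k = n - 1`) if it is `k`-bounded and `λ_1 + ℓ(λ) ≤ n`. -/
def IsKSmall (n : ℕ) (lam : YoungDiagram) : Prop :=
  lam.rowLen 0 < n ∧ lam.rowLen 0 + lam.colLen 0 ≤ n

/-- The standard reduced word of the affine Grassmannian element `x_λ` attached to a `k`-bounded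
partition: the residues (column minus row, mod `n`) of the boxes, read from the bottom row
to the top row and from right to left in each row:
`x_λ = ⋯ (s_{λ_2 - 2} ⋯ s_0 s_{-1}) (s_{λ_1 - 1} ⋯ s_1 s_0)`. -/
def readingWord (n : ℕ) (lam : YoungDiagram) : List (ZMod n) :=
  ((List.range (lam.colLen 0)).flatMap fun i =>
    (List.range (lam.rowLen i)).map fun j => (j : ZMod n) - (i : ZMod n)).reverse

/-- The (non-closed) `K`-theoretic double `k`-Schur function `g_λ^{(k)}(y|b) = T_{x_λ}(1)`,
where `k = n - 1`. -/
def g (n : ℕ) (lam : YoungDiagram) : Series n := Tword (readingWord n lam) 1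

/-- The functions `z_{i,i+d}`: `z_{ii} = Ω(b_i|y)` and
`(b_i - b_j) z_{ij} = z_{i,j-1} - z_{i+1,j}`, indices of `b` modulo `n`. -/
def zAux (n : ℕ) : ℕ → ℤ → Series n
  | 0, i => (Ω (i : ZMod n) : Series n)
  | d + 1, i =>
      cst (Ring.inverse (b (i : ZMod n) - b ((i + (d + 1 : ℕ) : ℤ) : ZMod n))) *
        (zAux n d i - zAux n d (i + 1))

/-- The entries `z_{ij}` of the upper-triangular matrix `Z`, extended periodically to `i, j ∈ ℤ`,
and regarded as power series in `y` (only used for `j - i < n`). -/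
def z (n : ℕ) (i j : ℤ) : Series n :=
  if i ≤ j then zAux n (j - i).toNat i else 0

/-- The entries of the bidiagonal matrix `A`, extended periodically: `A_{jj} = e^{-a_j}` and
`A_{j,j+1} = -1`. -/
def A (n : ℕ) (i j : ℤ) : RTΔ n :=
  if i = j then ex (-a (j : ZMod n)) else if i + 1 = j then -1 else 0

/-- The entries of the matrix product `Z A`; since `Z` and `A` are upper-triangular only the
indices `i ≤ m ≤ j` contribute. -/
def ZA (n : ℕ) (i j : ℤ) : Series n :=
  ∑ m ∈ Finset.Icc i j, z n i m * cst (A n m j)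

/-- The relations `[A, Z] = 0` defining the centralizer family. -/
theorem z_relation (n : ℕ) {i j : ℤ} (hij : i < j) (h : (i : ZMod n) ≠ (j : ZMod n)) :
    cst (b (i : ZMod n) - b (j : ZMod n)) * z n i j = z n i (j - 1) - z n (i + 1) j := by
  obtain ⟨d, rfl⟩ : ∃ d : ℕ, j = i + (d + 1 : ℕ) :=
    ⟨(j - i - 1).toNat, by omega⟩
  have e1 : (i + ((d + 1 : ℕ) : ℤ) - i).toNat = d + 1 := by omega
  have e2 : (i + ((d + 1 : ℕ) : ℤ) - 1 - i).toNat = d := by omega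
  have e3 : (i + ((d + 1 : ℕ) : ℤ) - (i + 1)).toNat = d := by omega
  have c2 : i ≤ i + ((d + 1 : ℕ) : ℤ) - 1 := by omega
  have c3 : i + 1 ≤ i + ((d + 1 : ℕ) : ℤ) := by omega
  rw [z, z, z, if_pos hij.le, if_pos c2, if_pos c3, e1, e2, e3, zAux, ← mul_assoc, ← map_mul,
    Ring.mul_inverse_cancel _ (isUnit_b_sub_b h), map_one, one_mul]

/-- For `0 ≤ m` and the column `p + 1` of `λ`, the complete symmetric polynomial
`f_m^{⟨m,p+1⟩;λ} = h_m (e^{-a_{res(s,p+1)}} | m ≤ s ≤ λ'_{p+1})`, where `s` numbers the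
rows from `1`. -/
def f (n : ℕ) (lam : YoungDiagram) (m p : ℕ) : RTΔ n :=
  MvPolynomial.aeval
    (fun s : Finset.Icc m (lam.colLen p) => ex (-a (((p : ℤ) + 1 - (s : ℕ) : ℤ) : ZMod n)))
    (MvPolynomial.hsymm (Finset.Icc m (lam.colLen p)) ℤ m)

/-- The lower block `W_λ`. Its row `p + 1` (for `0 ≤ p < λ_1`) has the entry
`(-1)^m f_m^{⟨m,p+1⟩;λ}` in the column numbered `n + p + 1 - m` for `m ≥ 0` (so the entry `1`
in the column `n + p + 1`) and `0` in the columns further to the right. The columns of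
the whole matrix are numbered by `l, ..., n + r`. -/
def W (n : ℕ) (lam : YoungDiagram) (p : ℕ) (c : ℤ) : RTΔ n :=
  if c ≤ n + p + 1 then
    (-1) ^ ((n : ℤ) + p + 1 - c).toNat * f n lam ((n : ℤ) + p + 1 - c).toNat p
  else 0

/-- `l = n - λ'_1 + 1`. -/
def l (n : ℕ) (lam : YoungDiagram) : ℤ := (n : ℤ) - lam.colLen 0 + 1

/-- The square matrix `N_λ` of size `λ'_1 + λ_1`. Its columns correspond to `l, ..., n + r` with
`r = λ_1`; its upper block is `(ZA)_{[l,n]}^{[l,n+r]}` and its lower block is `W_λ`. -/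
def N (n : ℕ) (lam : YoungDiagram) :
    Matrix (Fin (lam.colLen 0 + lam.rowLen 0)) (Fin (lam.colLen 0 + lam.rowLen 0)) (Series n) :=
  Matrix.of fun p q =>
    if (p : ℕ) < lam.colLen 0 then ZA n (l n lam + (p : ℕ)) (l n lam + (q : ℕ))
    else cst (W n lam ((p : ℕ) - lam.colLen 0) (l n lam + (q : ℕ)))

/-- `ξ_λ(y) = ∏_{i=1}^{λ'_1} Ω(b_{res(i,1)}|y)`. -/
def ξ (n : ℕ) (lam : YoungDiagram) : (Series n)ˣ :=
  ∏ i ∈ Finset.range (lam.colLen 0), Ω (-(i : ZMod n))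

/-- `∑_{x ∈ diag(λ)} (a_{r(x)+1} - a_{b(x)})`, where for the box `x` in row and column `i + 1`
the rightmost box of its row has residue `r(x) = λ_{i+1} - (i + 1)`, and the bottom
box of its column has residue `b(x) = (i + 1) - λ'_{i+1}`. -/
def diagWeight (n : ℕ) (lam : YoungDiagram) : Weight n :=
  ∑ i ∈ (Finset.range (lam.colLen 0)).filter (fun i => (i, i) ∈ lam),
    (a ((((lam.rowLen i : ℤ) - (i + 1)) + 1 : ℤ) : ZMod n) -
      a ((((i : ℤ) + 1) - lam.colLen i : ℤ) : ZMod n))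

/-- `∑_{i=1}^{λ'_1} a_{res(i,1)}`. -/
def columnWeight (n : ℕ) (lam : YoungDiagram) : Weight n :=
  ∑ i ∈ Finset.range (lam.colLen 0), a (-(i : ZMod n))

end KSchur

end

noncomputable section

namespace KSchur

/-! Multiplying `N` by a Newton basis turns it into a matrix of values at nodes, on which the
reflections act by permuting columns. Let `L = λ'_1`, let `β_k` be the `b` attached to column `k` of
`N` (columns counted from 0), and let `V` have entries `∏_{t<q} (β_k - β_t)`. Since `λ_1 + L ≤ n`,
the nodes belong to distinct residues and `det V` is a unit. The entries of `ZA` are divided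
differences of the values `F_k = e^{-a_k} Ω(b_k|y)`, so in `N V` an upper row becomes `F_k ∏_{t<p}
(β_k - β_t)` (`sum_ZA`). The row of `W` for a column of height `h` contains the Newton coefficients
of `(β_k - 1)^h` and becomes `(β_k - 1)^h ∏_{t<p-h} (β_k - β_t)` (`sum_W`). Hence `N V` is
`shapeMatrix`, which makes sense for every intermediate shape. The proof follows `det V · ξ · Y =
e^M · det(shapeMatrix)` (`Invariant`) while the operators `T_i` add the boxes one at a time,
starting from `Y = 1` and the empty shape. A reflection exchanges two adjacent nodes: `det V`
changes sign, `ξ` absorbs the twist of `s_0`, and up to sign only one row of `shapeMatrix` changes.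
On that row `T_i` produces one more factor `β_k - 1`, that is, one more box
(`det_shapeMatrix_add_box`, `Invariant.T`). For the full shape `det V` cancels, and `M` is the
weight of the theorem by a count of contents (`sum_diag`). -/

theorem prod_range_swap {B : Type*} [CommMonoid B] (f : ℕ → B) {c p : ℕ} (h : p ≠ c + 1) :
    ∏ t ∈ Finset.range p, f (Equiv.swap c (c + 1) t) = ∏ t ∈ Finset.range p, f t := by
  refine Finset.prod_equiv (Equiv.swap c (c + 1)) (fun t => ?_) (fun _ _ => rfl)
  simp only [Finset.mem_range, Equiv.swap_apply_def]
  split_ifs <;> omega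

theorem prod_range_succ_swap {B : Type*} [CommMonoid B] (f : ℕ → B) (c : ℕ) :
    ∏ t ∈ Finset.range (c + 1), f (Equiv.swap c (c + 1) t) =
      (∏ t ∈ Finset.range c, f t) * f (c + 1) := by
  rw [Finset.prod_range_succ, prod_range_swap f (by omega), Equiv.swap_apply_left]

/-! ### Determinants in Newton form, the effect of adding a box, and interpolation. -/

section Newton

variable {B : Type*} [CommRing B]

/-- The square matrix with the rows `F_k ∏_{t < p} (β_k - γ_t)` for `p < L` and the rows `u p`
for `p ≥ L`. -/
def newtonMatrix (m L : ℕ) (F β γ : ℕ → B) (u : ℕ → ℕ → B) : Matrix (Fin m) (Fin m) B :=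
  Matrix.of fun p k =>
    if (p : ℕ) < L then F k * ∏ t ∈ Finset.range p, (β k - γ t) else u p k

/-- Only the product of length `c + 1` sees the order of `γ_c` and `γ_{c+1}`, and its change is a
multiple of the row above. If `c + 1 ≥ L`, no upper row has that length. -/
theorem det_newtonMatrix_swap {m L c : ℕ} (hc : c + 1 < m) (F β γ : ℕ → B) (u : ℕ → ℕ → B) :
    (newtonMatrix m L F β (fun t => γ (Equiv.swap c (c + 1) t)) u).det =
      (newtonMatrix m L F β γ u).det := by
  by_cases hL : c + 1 < L
  · have key : newtonMatrix m L F β (fun t => γ (Equiv.swap c (c + 1) t)) u =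
        (newtonMatrix m L F β γ u).updateRow ⟨c + 1, hc⟩
          (newtonMatrix m L F β γ u ⟨c + 1, hc⟩ +
            (γ c - γ (c + 1)) • newtonMatrix m L F β γ u ⟨c, by omega⟩) := by
      ext p k
      rw [Matrix.updateRow_apply]
      split_ifs with hp
      · subst hp
        simp only [newtonMatrix, Matrix.of_apply, if_pos hL, Pi.add_apply, Pi.smul_apply,
          smul_eq_mul, if_pos (show c < L by omega)]
        rw [prod_range_succ_swap (fun t => β k - γ t), Finset.prod_range_succ]
        ring
      · have hp' : (p : ℕ) ≠ c + 1 := fun h => hp (Fin.ext h)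
        simp only [newtonMatrix, Matrix.of_apply]
        rw [prod_range_swap (fun t => β k - γ t) hp']
    rw [key, Matrix.det_updateRow_add_smul_self]
    intro h
    simp at h
  · congr 1
    ext p k
    simp only [newtonMatrix, Matrix.of_apply]
    split_ifs with hp
    · rw [prod_range_swap (fun t => β k - γ t) (by omega)]
    · rfl

/-- Applying `σ` swaps two columns, which gives the sign, and also swaps two nodes inside the
products, which `det_newtonMatrix_swap` undoes in the upper rows. -/
theorem map_det_newtonMatrix {m L c : ℕ} (hc : c + 1 < m) (F β : ℕ → B) (u u' : ℕ → ℕ → B)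
    (σ : B →+* B) (hF : ∀ t < m, σ (F t) = F (Equiv.swap c (c + 1) t))
    (hβ : ∀ t < m, σ (β t) = β (Equiv.swap c (c + 1) t))
    (hu : ∀ p k, L ≤ p → p < m → k < m → σ (u p k) = u' p (Equiv.swap c (c + 1) k)) :
    σ (newtonMatrix m L F β β u).det = - (newtonMatrix m L F β β u').det := by
  have hne : (⟨c, by omega⟩ : Fin m) ≠ ⟨c + 1, hc⟩ := by simp
  have hval : ∀ k : Fin m, ((Equiv.swap (⟨c, by omega⟩ : Fin m) ⟨c + 1, hc⟩ k : Fin m) : ℕ) =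
      Equiv.swap c (c + 1) (k : ℕ) := by
    intro k
    simp only [Equiv.swap_apply_def, Fin.ext_iff]
    split_ifs <;> rfl
  have key : σ.mapMatrix (newtonMatrix m L F β β u) =
      (newtonMatrix m L F β (fun t => β (Equiv.swap c (c + 1) t)) u').submatrix id
        (Equiv.swap (⟨c, by omega⟩ : Fin m) ⟨c + 1, hc⟩) := by
    ext p k
    simp only [RingHom.mapMatrix_apply, Matrix.map_apply, newtonMatrix, Matrix.of_apply,
      Matrix.submatrix_apply, id, hval]
    split_ifs with hp
    · rw [map_mul, map_prod, hF k k.2]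
      congr 1
      refine Finset.prod_congr rfl fun t ht => ?_
      rw [map_sub, hβ k k.2, hβ t ((Finset.mem_range.1 ht).trans p.2)]
    · exact hu p k (by omega) p.2 k.2
  rw [RingHom.map_det, key, Matrix.det_permute', det_newtonMatrix_swap hc, Equiv.Perm.sign_swap hne]
  simp

/-- The lower rows `(β_k - 1)^h ∏_{t < p - h} (β_k - β_t)`, where `h` is the height of the
column `p - L`. -/
def columnRow (L : ℕ) (β : ℕ → B) (h : ℕ → ℕ) (p k : ℕ) : B :=
  (β k - 1) ^ h (p - L) * ∏ t ∈ Finset.range (p - h (p - L)), (β k - β t)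

/-- The evaluation at the points `β_k` of the rows of `N_λ`, for a shape with column heights `h`. -/
def shapeMatrix (m L : ℕ) (F β : ℕ → B) (h : ℕ → ℕ) : Matrix (Fin m) (Fin m) B :=
  newtonMatrix m L F β β (columnRow L β h)

/-- The Newton matrix `∏_{t < p} (β_k - β_t)`. -/
def newtonBasis (m : ℕ) (β : ℕ → B) : Matrix (Fin m) (Fin m) B :=
  Matrix.of fun p k => ∏ t ∈ Finset.range p, (β k - β t)

theorem newtonBasis_eq (m : ℕ) (β : ℕ → B) :
    newtonBasis m β = newtonMatrix m m 1 β β 0 := by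
  ext p k
  simp [newtonBasis, newtonMatrix]

theorem newtonBasis_eq_zero {m : ℕ} (β : ℕ → B) {p k : Fin m} (h : k < p) :
    newtonBasis m β p k = 0 :=
  Finset.prod_eq_zero (Finset.mem_range.2 h) (sub_self _)

theorem map_det_newtonBasis {m c : ℕ} (hc : c + 1 < m) (β : ℕ → B) (σ : B →+* B)
    (hβ : ∀ t < m, σ (β t) = β (Equiv.swap c (c + 1) t)) :
    σ (newtonBasis m β).det = - (newtonBasis m β).det := by
  rw [newtonBasis_eq]
  exact map_det_newtonMatrix hc _ _ _ _ σ (fun _ _ => map_one σ) hβ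
    (fun p k h1 h2 => absurd h1 (by omega))

theorem det_newtonBasis (m : ℕ) (β : ℕ → B) :
    (newtonBasis m β).det = ∏ p : Fin m, ∏ t ∈ Finset.range p, (β p - β t) :=
  Matrix.det_of_isUpperTriangular fun _ _ h => newtonBasis_eq_zero β h

theorem isUnit_det_newtonBasis {m : ℕ} {β : ℕ → B}
    (hβ : ∀ s t, s < m → t < m → s ≠ t → IsUnit (β s - β t)) :
    IsUnit (newtonBasis m β).det := by
  rw [det_newtonBasis, IsUnit.prod_univ_iff]
  intro p
  rw [IsUnit.prod_iff]
  intro t ht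
  have := Finset.mem_range.1 ht
  exact hβ _ _ p.2 (this.trans p.2) (by omega)

/-- Without boxes the lower rows are Newton products too, so the matrix is triangular and only the
first `L` diagonal entries carry a factor `F`. -/
theorem det_shapeMatrix_zero {m L : ℕ} (hL : L ≤ m) (F β : ℕ → B) (h : ℕ → ℕ)
    (hh : ∀ p, h p = 0) :
    (shapeMatrix m L F β h).det = (∏ t ∈ Finset.range L, F t) * (newtonBasis m β).det := by
  have key : shapeMatrix m L F β h =
      Matrix.of fun p k : Fin m => (if (p : ℕ) < L then F k else 1) * newtonBasis m β p k := by
    ext p k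
    simp [shapeMatrix, newtonMatrix, columnRow, newtonBasis, hh]
  have e : ∏ x : Fin m, (if (x : ℕ) < L then F x else 1) = ∏ t ∈ Finset.range L, F t := by
    rw [Fin.prod_univ_eq_prod_range (fun t => if t < L then F t else 1) m, ← Finset.prod_filter]
    congr 1
    ext t
    simp only [Finset.mem_filter, Finset.mem_range]
    omega
  rw [det_newtonBasis, key, Matrix.det_of_isUpperTriangular]
  · simp only [Matrix.of_apply, Finset.prod_mul_distrib, e]
    rfl
  · intro p k hpk
    simp only [Matrix.of_apply, newtonBasis_eq_zero β (show k < p from hpk), mul_zero]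

/-- Adding a box to the column `j` of height `i`. -/
theorem det_shapeMatrix_add_box {m L c i j : ℕ} (hc : c + 1 < m) (hcij : c + 1 + i = L + j) (hj : L + j < m)
    (F β : ℕ → B) (h h' : ℕ → ℕ) (hh : h j = i) (hh' : h' j = i + 1)
    (hne : ∀ p, p ≠ j → h' p = h p) (hend : ∀ p, p ≠ j → L + p - h p ≠ c + 1)
    (σ : B →+* B) (hF : ∀ t < m, σ (F t) = F (Equiv.swap c (c + 1) t))
    (hβ : ∀ t < m, σ (β t) = β (Equiv.swap c (c + 1) t))
    (τ : B) (hτ : β c - τ * β (c + 1) = 1 - τ) :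
    - (τ * σ (shapeMatrix m L F β h).det) - (shapeMatrix m L F β h).det =
      (τ - 1) * (shapeMatrix m L F β h').det := by
  -- The lower rows after `σ`, with the column swap undone: only the nodes inside the products
  -- remain exchanged.
  set u' : ℕ → ℕ → B := fun p k =>
    (β k - 1) ^ h (p - L) *
      ∏ t ∈ Finset.range (p - h (p - L)), (β k - β (Equiv.swap c (c + 1) t)) with hu'
  have h1 : σ (shapeMatrix m L F β h).det = - (newtonMatrix m L F β β u').det := by
    refine map_det_newtonMatrix hc _ _ _ _ σ hF hβ fun p k _ hp hk => ?_
    simp only [columnRow, hu', map_mul, map_pow, map_sub, map_one, map_prod, hβ k hk]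
    congr 1
    refine Finset.prod_congr rfl fun t ht => ?_
    rw [hβ t (by have := Finset.mem_range.1 ht; omega)]
  set D := shapeMatrix m L F β h with hD
  set P : Fin m → B := fun k => (β k - 1) ^ i * ∏ t ∈ Finset.range c, (β k - β t) with hP
  have e0 : L + j - i = c + 1 := by omega
  have row : ∀ p : Fin m, p ≠ ⟨L + j, hj⟩ → ¬ (p : ℕ) < L → (p : ℕ) - L ≠ j := by
    intro p hp hL hpj
    exact hp (Fin.ext (by simp only; omega))
  -- By `hend`, the column `j` is the only one whose product has length `c + 1`, so `σ`, its
  -- conjugate shape and the enlarged shape all differ from `D` in a single row, with common factor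
  -- `P`.
  have hA : newtonMatrix m L F β β u' =
      D.updateRow ⟨L + j, hj⟩ (fun k => P k * (β k - β (c + 1))) := by
    ext p k
    rw [Matrix.updateRow_apply]
    split_ifs with hp
    · subst hp
      simp only [newtonMatrix, Matrix.of_apply, hu', hP, if_neg (show ¬ L + j < L by omega),
        Nat.add_sub_cancel_left, hh, e0, prod_range_succ_swap (fun t => β k - β t)]
      ring
    · simp only [newtonMatrix, Matrix.of_apply, hD, shapeMatrix]
      split_ifs with hL
      · rfl
      · have := hend _ (row p hp hL)
        simp only [hu', columnRow]
        rw [prod_range_swap (fun t => β k - β t) (by omega)]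
  have hB : D = D.updateRow ⟨L + j, hj⟩ (fun k => P k * (β k - β c)) := by
    ext p k
    rw [Matrix.updateRow_apply]
    split_ifs with hp
    · subst hp
      simp only [hD, shapeMatrix, newtonMatrix, Matrix.of_apply, columnRow, hP,
        if_neg (show ¬ L + j < L by omega), Nat.add_sub_cancel_left, hh, e0,
        Finset.prod_range_succ]
      ring
    · rfl
  have hC : shapeMatrix m L F β h' =
      D.updateRow ⟨L + j, hj⟩ (fun k => P k * (β k - 1)) := by
    ext p k
    rw [Matrix.updateRow_apply]
    split_ifs with hp
    · subst hp
      simp only [shapeMatrix, newtonMatrix, Matrix.of_apply, columnRow, hP,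
        if_neg (show ¬ L + j < L by omega), Nat.add_sub_cancel_left, hh',
        show L + j - (i + 1) = c by omega]
      ring
    · simp only [hD, shapeMatrix, newtonMatrix, Matrix.of_apply]
      split_ifs with hL
      · rfl
      · simp only [columnRow, hne _ (row p hp hL)]
  -- By `hτ`, `τ (β_k - β_{c+1}) = (β_k - β_c) + (τ - 1)(β_k - 1)`; the determinant is linear in
  -- this row.
  have hlin : τ * (D.updateRow ⟨L + j, hj⟩ (fun k => P k * (β k - β (c + 1)))).det =
      (D.updateRow ⟨L + j, hj⟩ (fun k => P k * (β k - β c))).det +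
        (τ - 1) * (D.updateRow ⟨L + j, hj⟩ (fun k => P k * (β k - 1))).det := by
    rw [← Matrix.det_updateRow_smul, ← Matrix.det_updateRow_smul, ← Matrix.det_updateRow_add]
    congr 2
    funext k
    simp only [Pi.smul_apply, Pi.add_apply, smul_eq_mul]
    linear_combination (P k) * hτ
  rw [h1, hA, hC]
  nth_rw 2 [hB]
  linear_combination hlin

/-- Newton interpolation for a triangular array satisfying the divided difference relations. -/
theorem newton_interpolation {m : ℕ} (β : ℕ → B) (G : ℕ → ℕ → B)
    (hG : ∀ p q, p < q → q < m → (β p - β q) * G p q = G p (q - 1) - G (p + 1) q)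
    {p k : ℕ} (hpk : p ≤ k) (hk : k < m) :
    ∑ q ∈ Finset.Icc p k, G p q * ∏ t ∈ Finset.Ico p q, (β k - β t) = G k k := by
  -- The same interpolation polynomial with the node `β_p` introduced last instead of first. At `y =
  -- β_k`, `r = k`, the extra term vanishes and `p` can be increased; no division by differences of
  -- nodes occurs.
  have step : ∀ y p r, p ≤ r → r < m →
      ∑ q ∈ Finset.Icc p r, G p q * ∏ t ∈ Finset.Ico p q, (y - β t) =
        ∑ q ∈ Finset.Icc (p + 1) r, G (p + 1) q * ∏ t ∈ Finset.Ico (p + 1) q, (y - β t) +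
          G p r * ∏ t ∈ Finset.Ico (p + 1) (r + 1), (y - β t) := by
    intro y p r hpr
    induction r, hpr using Nat.le_induction with
    | base => simp
    | succ r hpr ih =>
      intro hr
      have h := hG p (r + 1) (by omega) hr
      rw [Nat.add_sub_cancel] at h
      rw [Finset.sum_Icc_succ_top (by omega), ih (by omega), Finset.sum_Icc_succ_top (by omega),
        Finset.prod_Ico_succ_top (by omega : p + 1 ≤ r + 1),
        Finset.prod_eq_prod_Ico_succ_bot (by omega : p < r + 1)]
      linear_combination -(∏ t ∈ Finset.Ico (p + 1) (r + 1), (y - β t)) * h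
  obtain ⟨d, rfl⟩ : ∃ d, k = p + d := ⟨k - p, by omega⟩
  induction d generalizing p with
  | zero => simp
  | succ d ih =>
    rw [step _ p _ hpk hk, Finset.prod_eq_zero (i := p + (d + 1)) (by simp) (sub_self _),
      mul_zero, add_zero, show p + (d + 1) = p + 1 + d by omega]
    exact ih (by omega) (by omega)

/-- The powers in the Newton basis: the coefficients are complete homogeneous polynomials,
characterized by their recursion. -/
theorem pow_eq_sum_newton (x : ℕ → B) (H : ℕ → ℕ → B) (hzero : ∀ c, H c 0 = 1)
    (hempty : ∀ d, H 0 (d + 1) = x 0 * H 0 d)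
    (hrec : ∀ c d, H (c + 1) (d + 1) = H c (d + 1) + x (c + 1) * H (c + 1) d) (y : B) (d : ℕ) :
    ∑ c ∈ Finset.range (d + 1), H c (d - c) * ∏ t ∈ Finset.range c, (y - x t) = y ^ d := by
  induction d with
  | zero => simp [hzero]
  | succ d ih =>
    have h1 : ∀ c ∈ Finset.range d, H (c + 1) (d + 1 - (c + 1)) *
        ∏ t ∈ Finset.range (c + 1), (y - x t) =
        H c (d - c) * (∏ t ∈ Finset.range c, (y - x t)) * (y - x c) +
        x (c + 1) * (H (c + 1) (d - (c + 1)) * ∏ t ∈ Finset.range (c + 1), (y - x t)) := by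
      intro c hc
      have := Finset.mem_range.1 hc
      obtain ⟨e, rfl⟩ : ∃ e, d = c + 1 + e := ⟨d - (c + 1), by omega⟩
      rw [show c + 1 + e + 1 - (c + 1) = e + 1 by omega, show c + 1 + e - c = e + 1 by omega,
        show c + 1 + e - (c + 1) = e by omega, hrec, Finset.prod_range_succ]
      ring
    have h2 : ∑ c ∈ Finset.range (d + 1),
        x c * (H c (d - c) * ∏ t ∈ Finset.range c, (y - x t)) =
        ∑ c ∈ Finset.range d, x (c + 1) * (H (c + 1) (d - (c + 1)) *
          ∏ t ∈ Finset.range (c + 1), (y - x t)) + x 0 * H 0 d := by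
      rw [Finset.sum_range_succ']
      simp
    have h3 : ∑ c ∈ Finset.range (d + 1),
        (H c (d - c) * ∏ t ∈ Finset.range c, (y - x t)) * (y - x c) =
        ∑ c ∈ Finset.range d, H c (d - c) * (∏ t ∈ Finset.range c, (y - x t)) * (y - x c) +
          ∏ t ∈ Finset.range (d + 1), (y - x t) := by
      rw [Finset.sum_range_succ, Finset.prod_range_succ]
      simp [hzero]
    -- Split `y = (y - x_c) + x_c` in the term of index `c`: the first part lengthens the product,
    -- the second feeds the recursion of `H`.
    have h4 : y * ∑ c ∈ Finset.range (d + 1), H c (d - c) * ∏ t ∈ Finset.range c, (y - x t) =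
        ∑ c ∈ Finset.range (d + 1),
          (H c (d - c) * ∏ t ∈ Finset.range c, (y - x t)) * (y - x c) +
        ∑ c ∈ Finset.range (d + 1),
          x c * (H c (d - c) * ∏ t ∈ Finset.range c, (y - x t)) := by
      rw [Finset.mul_sum, ← Finset.sum_add_distrib]
      exact Finset.sum_congr rfl fun c _ => by ring
    rw [Finset.sum_range_succ', Finset.sum_range_succ, Finset.sum_congr rfl h1,
      Finset.sum_add_distrib]
    simp only [Nat.sub_self, hzero, Nat.sub_zero, Finset.range_zero, Finset.prod_empty, mul_one,
      one_mul, hempty]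
    rw [pow_succ', ← ih, h4, h2, h3]
    ring


end Newton

/-! ### Complete homogeneous polynomials and their recursion in the number of variables. -/

section CompleteHomogeneous

variable {B : Type*} [CommRing B]

/-- The complete homogeneous symmetric polynomial of degree `d` in a family of elements. -/
def complete {α : Type*} [Fintype α] [DecidableEq α] (x : α → B) (d : ℕ) : B :=
  MvPolynomial.aeval x (MvPolynomial.hsymm α ℤ d)

variable {α γ : Type*} [Fintype α] [DecidableEq α] [Fintype γ] [DecidableEq γ]

theorem complete_zero (x : α → B) : complete x 0 = 1 := by
  simp [complete]

theorem complete_comp_equiv (e : α ≃ γ) (x : γ → B) (d : ℕ) :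
    complete (fun i => x (e i)) d = complete x d := by
  rw [complete, complete, ← MvPolynomial.rename_hsymm γ ℤ d e.symm, MvPolynomial.aeval_rename]
  congr 2
  funext i
  simp

theorem complete_eq_sum (x : α → B) (d : ℕ) :
    complete x d = ∑ s : Sym α d, (s.1.map x).prod := by
  simp only [complete, MvPolynomial.hsymm, map_sum, map_multiset_prod, Multiset.map_map]
  simp

theorem complete_of_isEmpty [IsEmpty α] (x : α → B) (d : ℕ) : complete x (d + 1) = 0 := by
  rw [complete_eq_sum, Finset.univ_eq_empty, Finset.sum_empty]

/-- A multiset of size `d + 1` either contains `none`, which can be removed once, or avoids it. -/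
theorem complete_option (x : Option α → B) (d : ℕ) :
    complete x (d + 1) = x none * complete x d + complete (fun i => x (some i)) (d + 1) := by
  simp only [complete_eq_sum]
  rw [← (symOptionSuccEquiv (α := α) (n := d)).symm.sum_comp, Fintype.sum_sum_type,
    Finset.mul_sum]
  congr 1
  · refine Finset.sum_congr rfl fun s _ => ?_
    change ((none ::ₛ s : Sym (Option α) (d + 1)).1.map x).prod = _
    change ((none ::ₘ s.1).map x).prod = _
    rw [Multiset.map_cons, Multiset.prod_cons]
  · refine Finset.sum_congr rfl fun s _ => ?_
    change ((s.1.map Function.Embedding.some).map x).prod = _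
    rw [Multiset.map_map]
    rfl

theorem complete_fin_succ (x : ℕ → B) (c d : ℕ) :
    complete (fun i : Fin (c + 1) => x i) (d + 1) =
      complete (fun i : Fin c => x i) (d + 1) +
        x c * complete (fun i : Fin (c + 1) => x i) d := by
  have h := complete_option
    (fun o : Option (Fin c) => x ((finSuccEquivLast (n := c)).symm o : Fin (c + 1))) d
  have e : ∀ d, complete
      (fun o : Option (Fin c) => x ((finSuccEquivLast (n := c)).symm o : Fin (c + 1))) d =
      complete (fun i : Fin (c + 1) => x i) d := fun d =>
    complete_comp_equiv (finSuccEquivLast (n := c)).symm (fun i : Fin (c + 1) => x i) d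
  rw [e, e] at h
  rw [h, add_comm]
  simp

/-- Expansion of a power in the Newton basis. -/
theorem neg_pow_eq_sum_complete (x : ℕ → B) (y : B) (d : ℕ) :
    ∑ c ∈ Finset.range (d + 1), (-1) ^ (d - c) * complete (fun i : Fin (c + 1) => x i) (d - c) *
      ∏ t ∈ Finset.range c, (x t - y) = (-y) ^ d := by
  have h := pow_eq_sum_newton (fun t => -x t)
    (fun c d => (-1) ^ d * complete (fun i : Fin (c + 1) => x i) d)
    (fun c => by simp [complete_zero])
    (fun d => by
      rw [complete_fin_succ, complete_of_isEmpty]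
      ring)
    (fun c d => by
      rw [complete_fin_succ x (c + 1)]
      ring) (-y) d
  rw [← h]
  refine Finset.sum_congr rfl fun c _ => ?_
  congr 1
  refine Finset.prod_congr rfl fun t _ => ?_
  ring

end CompleteHomogeneous

/-! ### Residues of the columns as interpolation nodes. -/

section Points

variable {n : ℕ}

/-- The residue attached to the column `t` of `N_λ`, where `L = λ'_1`. -/
def pt (n L t : ℕ) : ZMod n := (t : ZMod n) + 1 - (L : ZMod n)

theorem pt_succ (L t : ℕ) : pt n L (t + 1) = pt n L t + 1 := by
  simp only [pt, Nat.cast_add, Nat.cast_one]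
  ring

theorem pt_inj {L s t : ℕ} (hs : s < n) (ht : t < n) (h : pt n L s = pt n L t) : s = t := by
  have h' : ((s : ℕ) : ZMod n) = (t : ℕ) := by
    simpa [pt] using h
  rw [ZMod.natCast_eq_natCast_iff', Nat.mod_eq_of_lt hs, Nat.mod_eq_of_lt ht] at h'
  exact h'

theorem swap_pt {L c t : ℕ} (hc : c + 1 < n) (ht : t < n) :
    Equiv.swap (pt n L c) (pt n L c + 1) (pt n L t) = pt n L (Equiv.swap c (c + 1) t) := by
  rw [← pt_succ]
  rcases eq_or_ne t c with rfl | h1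
  · simp
  rcases eq_or_ne t (c + 1) with rfl | h2
  · simp
  rw [Equiv.swap_apply_of_ne_of_ne h1 h2, Equiv.swap_apply_of_ne_of_ne]
  · exact fun h => h1 (pt_inj ht (by omega) h)
  · exact fun h => h2 (pt_inj ht hc h)

theorem permRTΔ_b (s : Equiv.Perm (ZMod n)) (i : ZMod n) : permRTΔ s (b i) = b (s i) := by
  simp [b, permRTΔ_ex, permWeight_a]

theorem map_Ω (s : Equiv.Perm (ZMod n)) (i : ZMod n) :
    MvPowerSeries.map (permRTΔ s) (Ω i : Series n) = (Ω (s i) : Series n) := by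
  ext m
  rw [MvPowerSeries.coeff_map]
  change permRTΔ s (b i ^ m.degree) = b (s i) ^ m.degree
  rw [map_pow, permRTΔ_b]

theorem cst_mul (x y : RTΔ n) : cst (x * y) = cst x * cst y := map_mul _ _ _

/-- The nodes `b_i`, as constant power series. -/
def node (n L t : ℕ) : Series n := cst (b (pt n L t))

/-- The values `e^{-a_i} Ω(b_i|y)`. -/
def nodeValue (n L t : ℕ) : Series n := cst (ex (-a (pt n L t))) * (Ω (pt n L t) : Series n)

theorem map_node {L c t : ℕ} (hc : c + 1 < n) (ht : t < n) :
    MvPowerSeries.map (permRTΔ (Equiv.swap (pt n L c) (pt n L c + 1))) (node n L t) =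
      node n L (Equiv.swap c (c + 1) t) := by
  rw [node, cst, MvPowerSeries.map_C, permRTΔ_b, swap_pt hc ht]
  rfl

theorem map_nodeValue {L c t : ℕ} (hc : c + 1 < n) (ht : t < n) :
    MvPowerSeries.map (permRTΔ (Equiv.swap (pt n L c) (pt n L c + 1))) (nodeValue n L t) =
      nodeValue n L (Equiv.swap c (c + 1) t) := by
  rw [nodeValue, cst, map_mul, MvPowerSeries.map_C, permRTΔ_ex, map_neg, permWeight_a, map_Ω,
    swap_pt hc ht]
  rfl

theorem isUnit_node_sub_node {L s t : ℕ} (hs : s < n) (ht : t < n) (h : s ≠ t) :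
    IsUnit (node n L s - node n L t) := by
  rw [node, node, cst, cst, ← map_sub]
  exact (isUnit_b_sub_b fun e => h (pt_inj hs ht e)).map _

end Points

/-! ### The operators `T_i` acting on the determinantal invariant. -/

section Operators

variable {n : ℕ}

/-- The product of the series `Ω` over the residues of the first column. -/
def columnProd (n L : ℕ) : Series n := ∏ t ∈ Finset.range L, (Ω (pt n L t) : Series n)

/-- The residues in the product are `1 - L, ..., 0`, so only the exchange of `0` and `1` alters it.
The resulting factor is exactly the twist of `s_0`: multiplication by `columnProd` turns the twisted
action into the action on coefficients. -/
theorem map_columnProd {L c : ℕ} (hL : 0 < L) (hLn : L ≤ n) (hc : c + 1 < n) :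
    MvPowerSeries.map (permRTΔ (Equiv.swap (pt n L c) (pt n L c + 1))) (columnProd n L) =
      (if pt n L c = 0 then ((Ω (1 : ZMod n) / Ω (0 : ZMod n) : (Series n)ˣ) : Series n) else 1) *
        columnProd n L := by
  have h0 : pt n L (L - 1) = 0 := by
    rw [pt, Nat.cast_sub hL]
    simp
  have h : MvPowerSeries.map (permRTΔ (Equiv.swap (pt n L c) (pt n L c + 1))) (columnProd n L) =
      ∏ t ∈ Finset.range L, (Ω (pt n L (Equiv.swap c (c + 1) t)) : Series n) := by
    rw [columnProd, map_prod]
    refine Finset.prod_congr rfl fun t ht => ?_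
    rw [map_Ω, swap_pt hc ((Finset.mem_range.1 ht).trans_le hLn)]
  rw [h]
  by_cases hcL : L = c + 1
  · subst hcL
    rw [Nat.add_sub_cancel] at h0
    rw [if_pos h0, prod_range_succ_swap (fun t => (Ω (pt n (c + 1) t) : Series n)), columnProd,
      Finset.prod_range_succ, pt_succ, h0, zero_add]
    have e : ((Ω (1 : ZMod n) / Ω (0 : ZMod n) : (Series n)ˣ) : Series n) *
        (Ω (0 : ZMod n) : Series n) = (Ω (1 : ZMod n) : Series n) := by
      rw [← Units.val_mul, div_mul_cancel]
    rw [← e]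
    ring
  · rw [if_neg, prod_range_swap (fun t => (Ω (pt n L t) : Series n)) hcL, one_mul, columnProd]
    rw [← h0]
    exact fun e => hcL (by have := pt_inj (by omega) (by omega) e; omega)

/-- The weight `∑_{i ≤ L} a_{ρ_i - i + 1}`. -/
def rowWeight (n L : ℕ) (ρ : ℕ → ℕ) : Weight n :=
  ∑ i ∈ Finset.range L, a ((ρ i : ZMod n) - (i : ZMod n))

theorem shift_eq_pt {L i r : ℕ} (hi : i < L) :
    ((r : ZMod n) - (i : ZMod n)) = pt n L (r + (L - 1 - i)) := by
  rw [pt, Nat.cast_add, Nat.sub_sub, Nat.cast_sub (by omega : 1 + i ≤ L)]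
  push_cast
  ring

/-- The numbers `ρ_k + (L - 1 - k)` are the beta-numbers of the shape. Adding the box moves one of
them from `c` to `c + 1`, and by `hend` no other one equals either. -/
theorem permWeight_rowWeight {L c i j : ℕ} (hi : i < L) (hcij : c + 1 + i = L + j) (hc : c + 1 < n)
    (ρ ρ' : ℕ → ℕ) (hρ : ρ i = j) (hρ' : ρ' i = j + 1) (hne : ∀ k, k ≠ i → ρ' k = ρ k)
    (hlt : ∀ k < L, ρ k + (L - 1 - k) < n)
    (hend : ∀ k < L, k ≠ i → ρ k + L ≠ c + 1 + k ∧ ρ k + L ≠ c + 2 + k) :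
    permWeight (Equiv.swap (pt n L c) (pt n L c + 1)) (rowWeight n L ρ) = rowWeight n L ρ' := by
  rw [rowWeight, rowWeight, map_sum]
  refine Finset.sum_congr rfl fun k hk => ?_
  have hk := Finset.mem_range.1 hk
  rw [permWeight_a, shift_eq_pt hk, shift_eq_pt hk, swap_pt hc (hlt k hk)]
  congr 2
  rw [Equiv.swap_apply_def]
  by_cases hki : k = i
  · subst hki
    rw [if_pos (by omega)]
    omega
  · have := hend k hk hki
    rw [if_neg (by omega), if_neg (by omega), hne k hki]

theorem rowWeight_add_box {L c i j : ℕ} (hi : i < L) (hcij : c + 1 + i = L + j)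
    (ρ ρ' : ℕ → ℕ) (hρ : ρ i = j) (hρ' : ρ' i = j + 1) (hne : ∀ k, k ≠ i → ρ' k = ρ k) :
    rowWeight n L ρ' = rowWeight n L ρ + -α (pt n L c) := by
  have hi' := Finset.mem_range.2 hi
  rw [rowWeight, rowWeight, ← Finset.add_sum_erase _ _ hi',
    ← Finset.add_sum_erase _ (fun i => a ((ρ i : ZMod n) - (i : ZMod n))) hi',
    Finset.sum_congr rfl (fun k hk => by rw [hne k (Finset.ne_of_mem_erase hk)]), hρ, hρ',
    shift_eq_pt hi, shift_eq_pt hi, α, ← pt_succ, show j + (L - 1 - i) = c by omega,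
    show j + 1 + (L - 1 - i) = c + 1 by omega]
  abel

/-- The invariant satisfied by the successive images of `1` under the operators `T_i`. -/
def Invariant (n m L : ℕ) (ρ h : ℕ → ℕ) (Y : Series n) : Prop :=
  (newtonBasis m (node n L)).det * columnProd n L * Y =
    cst (ex (rowWeight n L ρ)) * (shapeMatrix m L (nodeValue n L) (node n L) h).det

theorem Invariant.T {m L c i j : ℕ} {ρ ρ' h h' : ℕ → ℕ} {Y : Series n}
    (H : Invariant n m L ρ h Y) (hm : m ≤ n) (hi : i < L) (hj : L + j < m)
    (hcij : c + 1 + i = L + j)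
    (hρ : ρ i = j) (hρ' : ρ' i = j + 1) (hρne : ∀ k, k ≠ i → ρ' k = ρ k)
    (hlt : ∀ k < L, ρ k + (L - 1 - k) < n)
    (hρend : ∀ k < L, k ≠ i → ρ k + L ≠ c + 1 + k ∧ ρ k + L ≠ c + 2 + k)
    (hh : h j = i) (hh' : h' j = i + 1) (hne : ∀ p, p ≠ j → h' p = h p)
    (hend : ∀ p, p ≠ j → L + p - h p ≠ c + 1) :
    Invariant n m L ρ' h' (KSchur.T (pt n L c) Y) := by
  have hc : c + 1 < m := by omega
  have hcn : c + 1 < n := by omega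
  set σ := MvPowerSeries.map (σ := ℕ) (permRTΔ (Equiv.swap (pt n L c) (pt n L c + 1))) with hσ
  have hadd := rowWeight_add_box (n := n) hi hcij ρ ρ' hρ hρ' hρne
  have hM := permWeight_rowWeight hi hcij hcn ρ ρ' hρ hρ' hρne hlt hρend
  have hα : pt n L c ≠ pt n L c + 1 := by
    rw [← pt_succ]
    exact fun e => by simpa using pt_inj (by omega) hcn e
  have hu : IsUnit (1 - ex (α (pt n L c)) : RTΔ n) := isUnit_one_sub_ex hα
  have hinv : ex (α (pt n L c)) * ex (-α (pt n L c)) = (1 : RTΔ n) := by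
    rw [← ex_add, add_neg_cancel, ex_zero]
  -- The prefactor of `T_i` times the `τ - 1` of `det_shapeMatrix_add_box`, with `τ = e^{-α}`,
  -- leaves `τ`, which is the growth of `rowWeight`.
  have hκ : Ring.inverse (1 - ex (α (pt n L c))) * (ex (-α (pt n L c)) - 1) =
      (ex (-α (pt n L c)) : RTΔ n) := by
    have h1 := Ring.inverse_mul_cancel _ hu
    linear_combination (ex (-α (pt n L c))) * h1 +
      (Ring.inverse (1 - ex (α (pt n L c)))) * hinv
  -- Equivalent to `1 - β_c = τ (1 - β_{c+1})`, since `1 - b_i = e^{-a_i}`.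
  have hτ : node n L c - cst (ex (-α (pt n L c))) * node n L (c + 1) =
      1 - cst (ex (-α (pt n L c))) := by
    have e : (b (pt n L c) - ex (-α (pt n L c)) * b (pt n L (c + 1)) : RTΔ n) =
        1 - ex (-α (pt n L c)) := by
      rw [b, b, mul_sub, ← ex_add, α, ← pt_succ, mul_one,
        show -(a (pt n L c) - a (pt n L (c + 1))) + -a (pt n L (c + 1)) = -a (pt n L c) by abel]
      ring
    rw [node, node]
    simpa using congrArg (MvPowerSeries.C (σ := ℕ)) e
  have hV : σ (newtonBasis m (node n L)).det = - (newtonBasis m (node n L)).det :=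
    map_det_newtonBasis hc _ σ fun t ht => map_node hcn (ht.trans_le hm)
  have hΞ := map_columnProd (n := n) (L := L) (by omega) (by omega) hcn
  have hD := det_shapeMatrix_add_box hc hcij hj (nodeValue n L) (node n L) h h' hh hh' hne hend σ
    (fun t ht => map_nodeValue hcn (ht.trans_le hm)) (fun t ht => map_node hcn (ht.trans_le hm))
    (cst (ex (-α (pt n L c)))) hτ
  have hσM : σ (cst (ex (rowWeight n L ρ))) =
      cst (ex (rowWeight n L ρ)) * cst (ex (-α (pt n L c))) := by
    rw [hσ, cst, MvPowerSeries.map_C, permRTΔ_ex, hM, hadd, ex_add, map_mul]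
  have hκ' := congrArg (MvPowerSeries.C (σ := ℕ)) hκ
  rw [map_mul, map_sub, map_one] at hκ'
  have hσH := congrArg σ H
  rw [map_mul, map_mul, hV, hΞ, map_mul, hσM] at hσH
  unfold Invariant at H ⊢
  rw [hadd, ex_add, cst_mul, KSchur.T, simpleReflection, ← hσ]
  linear_combination (-(cst (Ring.inverse (1 - ex (α (pt n L c)))))) * hσH -
    (cst (Ring.inverse (1 - ex (α (pt n L c))))) * H +
    (cst (Ring.inverse (1 - ex (α (pt n L c)))) * cst (ex (rowWeight n L ρ))) * hD +
    (cst (ex (rowWeight n L ρ)) * (shapeMatrix m L (nodeValue n L) (node n L) h').det) * hκ'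

theorem invariant_one {m L : ℕ} (hL : L ≤ m) :
    Invariant n m L 0 0 1 := by
  unfold Invariant
  rw [det_shapeMatrix_zero hL _ _ 0 (fun _ => rfl)]
  have e : ∏ t ∈ Finset.range L, nodeValue n L t =
      cst (ex (-rowWeight n L 0)) * columnProd n L := by
    have e1 : rowWeight n L 0 = ∑ t ∈ Finset.range L, a (pt n L t) := by
      rw [rowWeight, ← Finset.sum_range_reflect]
      refine Finset.sum_congr rfl fun t ht => ?_
      have := Finset.mem_range.1 ht
      rw [shift_eq_pt (L := L) (by omega)]
      congr 2
      simp only [Pi.zero_apply]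
      omega
    have e2 : ∀ s : Finset ℕ, ex (-∑ t ∈ s, a (pt n L t)) = ∏ t ∈ s, ex (-a (pt n L t)) := by
      intro s
      induction s using Finset.induction_on with
      | empty => simp [ex_zero]
      | insert x s hx ih => rw [Finset.sum_insert hx, Finset.prod_insert hx, neg_add, ex_add, ih]
    rw [e1, e2, columnProd, cst, map_prod, ← Finset.prod_mul_distrib]
    rfl
  have e3 : cst (ex (rowWeight n L 0)) * cst (ex (-rowWeight n L 0)) = (1 : Series n) := by
    rw [← map_mul, ← ex_add, add_neg_cancel, ex_zero, map_one]
  rw [e]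
  linear_combination -((newtonBasis m (node n L)).det * columnProd n L) * e3

end Operators


/-! ### Building the diagram box by box along the reading word. -/

section Word

variable {n : ℕ}

/-- The row lengths of the shape consisting of the first `i` rows of `λ` and of `j` boxes in
the next row. -/
def stageRow (lam : YoungDiagram) (i j k : ℕ) : ℕ :=
  if k < i then lam.rowLen k else if k = i then j else 0

/-- The column heights of the shape consisting of the first `i` rows of `λ` and of `j` boxes in
the next row. -/
def stageCol (lam : YoungDiagram) (i j p : ℕ) : ℕ :=
  if p < j then i + 1 else min (lam.colLen p) i

theorem lt_rowLen_iff (lam : YoungDiagram) (i j : ℕ) : j < lam.rowLen i ↔ i < lam.colLen j := by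
  rw [← YoungDiagram.mem_iff_lt_rowLen, YoungDiagram.mem_iff_lt_colLen]

/-- The end conditions of `Invariant.T` hold because row ends and column ends of a partition have
strictly monotone contents; smallness keeps the indices below `n`. -/
theorem Invariant.add_box {lam : YoungDiagram} (hlam : IsKSmall n lam) {i j : ℕ}
    (hj : j < lam.rowLen i) {Y : Series n}
    (H : Invariant n (lam.colLen 0 + lam.rowLen 0) (lam.colLen 0) (stageRow lam i j)
      (stageCol lam i j) Y) :
    Invariant n (lam.colLen 0 + lam.rowLen 0) (lam.colLen 0) (stageRow lam i (j + 1))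
      (stageCol lam i (j + 1)) (KSchur.T ((j : ZMod n) - (i : ZMod n)) Y) := by
  have hn := hlam.2
  have hi' : i < lam.colLen j := (lt_rowLen_iff lam i j).1 hj
  have hi : i < lam.colLen 0 := hi'.trans_le (lam.colLen_anti 0 j (Nat.zero_le _))
  have hrow : ∀ k, lam.rowLen k ≤ lam.rowLen 0 := fun k => lam.rowLen_anti 0 k (Nat.zero_le _)
  have hj0 := hrow i
  rw [shift_eq_pt hi]
  refine H.T (i := i) (j := j) (by omega) hi (by omega) (by omega) (by simp [stageRow])
    (by simp [stageRow]) ?_ ?_ ?_ ?_ (by simp [stageCol]) ?_ ?_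
  · intro k hk
    simp [stageRow, hk]
  · intro k _
    have := hrow k
    unfold stageRow
    split_ifs <;> omega
  · intro k hk hki
    unfold stageRow
    split_ifs with h1
    · have := lam.rowLen_anti k i h1.le
      omega
    · omega
  · simp only [stageCol, lt_irrefl, if_false]
    omega
  · intro p hp
    unfold stageCol
    split_ifs <;> omega
  · intro p hp
    unfold stageCol
    split_ifs <;> omega

theorem stageRow_succ (lam : YoungDiagram) (i : ℕ) :
    stageRow lam (i + 1) 0 = stageRow lam i (lam.rowLen i) := by
  funext k
  unfold stageRow
  rcases lt_trichotomy k i with h | rfl | h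
  · rw [if_pos (by omega), if_pos h]
  · simp
  · rw [if_neg (show ¬ k < i + 1 by omega), if_neg (show ¬ k < i by omega),
      if_neg (show ¬ k = i by omega), ite_self]

theorem stageCol_succ (lam : YoungDiagram) (i : ℕ) :
    stageCol lam (i + 1) 0 = stageCol lam i (lam.rowLen i) := by
  funext p
  have := lt_rowLen_iff lam i p
  unfold stageCol
  split_ifs <;> omega

theorem invariant_row {lam : YoungDiagram} (hlam : IsKSmall n lam) {i : ℕ} {Y : Series n}
    (H : Invariant n (lam.colLen 0 + lam.rowLen 0) (lam.colLen 0) (stageRow lam i 0)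
      (stageCol lam i 0) Y) (j : ℕ) (hj : j ≤ lam.rowLen i) :
    Invariant n (lam.colLen 0 + lam.rowLen 0) (lam.colLen 0) (stageRow lam i j)
      (stageCol lam i j)
      (((List.range j).map fun j : ℕ => (j : ZMod n) - (i : ZMod n)).foldl (fun f r => T r f) Y) := by
  induction j with
  | zero => exact H
  | succ j ih =>
    rw [List.range_succ, List.map_append, List.foldl_append]
    exact (ih (by omega)).add_box hlam hj

theorem invariant_rows {lam : YoungDiagram} (hlam : IsKSmall n lam) (i : ℕ) :
    Invariant n (lam.colLen 0 + lam.rowLen 0) (lam.colLen 0) (stageRow lam i 0)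
      (stageCol lam i 0)
      (((List.range i).flatMap fun i =>
        (List.range (lam.rowLen i)).map fun j : ℕ => (j : ZMod n) - (i : ZMod n)).foldl
          (fun f r => T r f) 1) := by
  induction i with
  | zero =>
    have h1 : stageRow lam 0 0 = 0 := by
      funext k
      simp [stageRow]
    have h2 : stageCol lam 0 0 = 0 := by
      funext k
      simp [stageCol]
    rw [h1, h2]
    exact invariant_one (Nat.le_add_right _ _)
  | succ i ih =>
    rw [List.range_succ, List.flatMap_append, List.foldl_append, List.flatMap_singleton,
      stageRow_succ, stageCol_succ]
    exact invariant_row hlam ih _ le_rfl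

theorem invariant_g {lam : YoungDiagram} (hlam : IsKSmall n lam) :
    Invariant n (lam.colLen 0 + lam.rowLen 0) (lam.colLen 0) lam.rowLen lam.colLen (g n lam) := by
  have h := invariant_rows hlam (lam.colLen 0)
  have h2 : stageCol lam (lam.colLen 0) 0 = lam.colLen := by
    funext p
    have := lam.colLen_anti 0 p (Nat.zero_le _)
    simp [stageCol, this]
  have h1 : rowWeight n (lam.colLen 0) (stageRow lam (lam.colLen 0) 0) =
      rowWeight n (lam.colLen 0) lam.rowLen :=
    Finset.sum_congr rfl fun k hk => by rw [stageRow, if_pos (Finset.mem_range.1 hk)]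
  have h3 : readingWord n lam = ((List.range (lam.colLen 0)).flatMap fun i =>
      (List.range (lam.rowLen i)).map fun j : ℕ => (j : ZMod n) - (i : ZMod n)).reverse := by
    simp [readingWord, ← List.map_eq_flatMap, Function.comp_def]
  rw [g, Tword, h3, List.foldr_reverse]
  unfold Invariant at h ⊢
  rwa [h1, h2] at h

end Word

/-! ### Comparison of the exponents. -/

section Weights

/-- The residues of the first column are those of the ends of the columns meeting the diagonal
and of the ends of the rows which do not meet it. -/
theorem sum_diag {M : Type*} [AddCommMonoid M] (lam : YoungDiagram) (φ : ℤ → M) :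
    ∑ i ∈ Finset.range (lam.colLen 0),
      φ (if (i, i) ∈ lam then (i : ℤ) + 1 - lam.colLen i else (lam.rowLen i : ℤ) - i) =
      ∑ i ∈ Finset.range (lam.colLen 0), φ (-(i : ℤ)) := by
  set e : ℕ → ℕ := fun i => if (i, i) ∈ lam then lam.colLen i - i - 1 else i - lam.rowLen i with he
  have hd1 : ∀ i, (i, i) ∈ lam → i < lam.colLen i := fun i h =>
    YoungDiagram.mem_iff_lt_colLen.1 h
  have hd2 : ∀ i, (i, i) ∉ lam → lam.rowLen i ≤ i := fun i h =>
    not_lt.1 fun h' => h (YoungDiagram.mem_iff_lt_rowLen.2 h')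
  have hinj : Set.InjOn e (Finset.range (lam.colLen 0)) := by
    -- The box `(j, i)` decides: if it lies in the diagram then `e i > e j`, otherwise `e i < e j`.
    have key : ∀ i j, (i, i) ∈ lam → (j, j) ∉ lam → e i ≠ e j := by
      intro i j hi hj h
      have h1 := hd1 i hi
      have h2 := hd2 j hj
      have h3 := lt_rowLen_iff lam j i
      simp only [he, if_pos hi, if_neg hj] at h
      omega
    have key2 : ∀ i j, i < j → e i ≠ e j := by
      intro i j hij
      by_cases hi : (i, i) ∈ lam <;> by_cases hj : (j, j) ∈ lam
      · have h1 := hd1 i hi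
        have h2 := hd1 j hj
        have h3 := lam.colLen_anti i j hij.le
        simp only [he, if_pos hi, if_pos hj]
        omega
      · exact key i j hi hj
      · exact (key j i hj hi).symm
      · have h1 := hd2 i hi
        have h2 := hd2 j hj
        have h3 := lam.rowLen_anti i j hij.le
        simp only [he, if_neg hi, if_neg hj]
        omega
    intro i _ j _ h
    by_contra hne
    rcases Nat.lt_or_gt_of_ne hne with h' | h'
    · exact key2 _ _ h' h
    · exact key2 _ _ h' h.symm
  have himg : (Finset.range (lam.colLen 0)).image e = Finset.range (lam.colLen 0) := by
    refine Finset.eq_of_subset_of_card_le ?_ (Finset.card_image_of_injOn hinj).ge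
    intro x hx
    obtain ⟨i, hi, rfl⟩ := Finset.mem_image.1 hx
    have hi := Finset.mem_range.1 hi
    have h3 := lam.colLen_anti 0 i (Nat.zero_le _)
    rw [Finset.mem_range, he]
    dsimp only
    split_ifs <;> omega
  have hsum : ∑ i ∈ Finset.range (lam.colLen 0), φ (-(i : ℤ)) =
      ∑ i ∈ Finset.range (lam.colLen 0), φ (-(e i : ℤ)) := by
    conv_lhs => rw [← himg]
    exact Finset.sum_image hinj
  rw [hsum]
  refine Finset.sum_congr rfl fun i _ => ?_
  congr 1
  simp only [he]
  split_ifs with h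
  · have := hd1 i h
    omega
  · have := hd2 i h
    omega

/-- Rewriting the first column by `sum_diag` cancels the terms `a_{b(x)}` and supplies the rows that
miss the diagonal. -/
theorem diagWeight_add_columnWeight (n : ℕ) (lam : YoungDiagram) :
    diagWeight n lam + columnWeight n lam = rowWeight n (lam.colLen 0) lam.rowLen := by
  have h := sum_diag lam (fun t : ℤ => (a (t : ZMod n) : Weight n))
  have h1 : columnWeight n lam =
      ∑ i ∈ Finset.range (lam.colLen 0), a (((-(i : ℤ) : ℤ)) : ZMod n) := by
    simp [columnWeight]
  rw [h1, ← h, diagWeight, Finset.sum_filter, ← Finset.sum_add_distrib, rowWeight]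
  refine Finset.sum_congr rfl fun i _ => ?_
  split_ifs with hi
  · rw [sub_add_cancel]
    congr 1
    push_cast
    ring
  · rw [zero_add]
    push_cast
    rfl

end Weights

/-! ### Evaluation of the rows of `N` at the nodes. -/

section Matrices

variable {n : ℕ}

theorem ZA_eq (n : ℕ) (i j : ℤ) :
    ZA n i j = z n i j * cst (ex (-a (j : ZMod n))) - z n i (j - 1) := by
  have h : ∀ m ∈ Finset.Icc i j, z n i m * cst (A n m j) =
      (if m = j then z n i m * cst (ex (-a (j : ZMod n))) else 0) -
        (if m = j - 1 then z n i m else 0) := by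
    intro m _
    unfold A
    split_ifs with h1 h2 h2 h3 h3
    · omega
    · rw [sub_zero]
    · simp
    · omega
    · omega
    · simp
  rw [ZA, Finset.sum_congr rfl h, Finset.sum_sub_distrib, Finset.sum_ite_eq', Finset.sum_ite_eq']
  have hz : ∀ t, t < i → z n i t = 0 := fun t ht => if_neg (by omega)
  simp only [Finset.mem_Icc]
  split_ifs with h1 h2 h2
  · rfl
  · rw [hz (j - 1) (by omega)]
  · omega
  · rw [hz j (by omega), hz (j - 1) (by omega), zero_mul]

theorem ZA_self (n : ℕ) (i : ℤ) :
    ZA n i i = cst (ex (-a (i : ZMod n))) * (Ω (i : ZMod n) : Series n) := by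
  rw [ZA_eq, z, z, if_pos le_rfl, if_neg (by omega), sub_self, Int.toNat_zero, zAux, sub_zero,
    mul_comm]

/-- `Z` commutes with `A`, hence so does `ZA`; in entries this is the divided difference recursion.
For `i = j - 1` the second relation needed is trivial, whence the guard in `h'`. -/
theorem ZA_relation (n : ℕ) {i j : ℤ} (hij : i < j)
    (h : (i : ZMod n) ≠ (j : ZMod n))
    (h' : i < j - 1 → (i : ZMod n) ≠ ((j - 1 : ℤ) : ZMod n)) :
    cst (b (i : ZMod n) - b (j : ZMod n)) * ZA n i j = ZA n i (j - 1) - ZA n (i + 1) j := by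
  have h1 := z_relation n hij h
  have h2 : cst (b (i : ZMod n) - b ((j - 1 : ℤ) : ZMod n)) * z n i (j - 1) =
      z n i (j - 1 - 1) - z n (i + 1) (j - 1) := by
    rcases (show i = j - 1 ∨ i < j - 1 by omega) with rfl | hlt
    · have e1 : z n (j - 1) (j - 1 - 1) = 0 := if_neg (by omega)
      have e2 : z n (j - 1 + 1) (j - 1) = 0 := if_neg (by omega)
      rw [e1, e2, sub_self, sub_self, cst, map_zero, zero_mul]
    · exact z_relation n hlt (h' hlt)
  simp only [ZA_eq, b, cst, map_sub, map_one] at h1 h2 ⊢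
  linear_combination (MvPowerSeries.C (ex (-a (j : ZMod n)))) * h1 - h2

theorem intCast_l (n : ℕ) (lam : YoungDiagram) (t : ℕ) :
    ((l n lam + t : ℤ) : ZMod n) = pt n (lam.colLen 0) t := by
  rw [l, pt]
  push_cast
  rw [ZMod.natCast_self]
  ring

theorem f_eq_zero {lam : YoungDiagram} {m p : ℕ} (h : lam.colLen p < m) : f n lam m p = 0 := by
  obtain ⟨m, rfl⟩ : ∃ d, m = d + 1 := ⟨m - 1, by omega⟩
  have : IsEmpty (Finset.Icc (m + 1) (lam.colLen p)) := by
    rw [Finset.Icc_eq_empty (by omega)]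
    infer_instance
  exact complete_of_isEmpty _ m

theorem f_eq_complete {lam : YoungDiagram} {c p : ℕ} (hc : c ≤ lam.colLen p) :
    f n lam (lam.colLen p - c) p =
      complete (fun i : Fin (c + 1) =>
        ex (-a (pt n (lam.colLen 0) (lam.colLen 0 + p - lam.colLen p + i))))
        (lam.colLen p - c) := by
  -- The variables are the residues of the lowest `c + 1` boxes of the column (or of box 0 as well,
  -- never reached unless `s = 0` is allowed by `c = λ'_{p+1}`), listed upwards by `s = λ'_{p+1} -
  -- i`.
  have h0 := lam.colLen_anti 0 p (Nat.zero_le _)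
  let e : Fin (c + 1) ≃ Finset.Icc (lam.colLen p - c) (lam.colLen p) :=
    { toFun := fun i => ⟨lam.colLen p - i, by rw [Finset.mem_Icc]; omega⟩
      invFun := fun s => ⟨lam.colLen p - s, by have := Finset.mem_Icc.1 s.2; omega⟩
      left_inv := fun i => by
        ext
        simp only
        omega
      right_inv := fun s => by
        ext
        have := Finset.mem_Icc.1 s.2
        simp only
        omega }
  refine (complete_comp_equiv e _ _).symm.trans ?_
  congr 1
  funext i
  have hi := i.2
  congr 3
  change (((p : ℤ) + 1 - ((lam.colLen p - i : ℕ) : ℤ) : ℤ) : ZMod n) = _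
  rw [pt, Nat.cast_sub (by omega : (i : ℕ) ≤ lam.colLen p), Nat.cast_add,
    Nat.cast_sub (by omega : lam.colLen p ≤ lam.colLen 0 + p)]
  push_cast
  ring

theorem sum_ZA {lam : YoungDiagram} {m p k : ℕ} (hm : m ≤ n) (hk : k < m) :
    ∑ q ∈ Finset.range m, ZA n (l n lam + p) (l n lam + q) *
      ∏ t ∈ Finset.range q, (node n (lam.colLen 0) k - node n (lam.colLen 0) t) =
    nodeValue n (lam.colLen 0) k *
      ∏ t ∈ Finset.range p, (node n (lam.colLen 0) k - node n (lam.colLen 0) t) := by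
  set β := node n (lam.colLen 0) with hβ
  have hzero : ∀ q, k < q → ∏ t ∈ Finset.range q, (β k - β t) = 0 := fun q hq =>
    Finset.prod_eq_zero (Finset.mem_range.2 hq) (sub_self _)
  have hZA : ∀ q, q < p → ZA n (l n lam + p) (l n lam + q) = 0 := fun q hq => by
    rw [ZA, Finset.Icc_eq_empty (by omega), Finset.sum_empty]
  rcases lt_or_ge k p with hkp | hpk
  · rw [hzero p hkp, mul_zero]
    refine Finset.sum_eq_zero fun q _ => ?_
    rcases lt_or_ge q p with h | h
    · rw [hZA q h, zero_mul]
    · rw [hzero q (by omega), mul_zero]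
  · have hsub : Finset.Icc p k ⊆ Finset.range m := fun q hq => by
      have := Finset.mem_Icc.1 hq
      exact Finset.mem_range.2 (by omega)
    rw [← Finset.sum_subset hsub]
    · have hN := newton_interpolation β (fun p q => ZA n (l n lam + (p : ℕ)) (l n lam + (q : ℕ)))
        (m := m) (fun p q hpq hq => ?_) hpk hk
      · have hF : nodeValue n (lam.colLen 0) k = ZA n (l n lam + k) (l n lam + k) := by
          rw [ZA_self, intCast_l]
          rfl
        rw [hF, ← hN, Finset.sum_mul]
        refine Finset.sum_congr rfl fun q hq => ?_
        rw [← Finset.prod_range_mul_prod_Ico _ (Finset.mem_Icc.1 hq).1]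
        ring
      · have hne : ∀ q', p < q' → q' < m →
            ((l n lam + p : ℤ) : ZMod n) ≠ ((l n lam + q' : ℤ) : ZMod n) := by
          intro q' h1 h2 h
          rw [intCast_l, intCast_l] at h
          have := pt_inj (by omega) (by omega) h
          omega
        have e1 : l n lam + (q : ℤ) - 1 = l n lam + ((q - 1 : ℕ) : ℤ) := by omega
        have h := ZA_relation n (i := l n lam + p) (j := l n lam + q) (by omega) (hne q hpq hq)
          (fun h => by
            rw [e1] at h ⊢
            exact hne (q - 1) (by omega) (by omega))
        rw [e1, intCast_l, intCast_l, cst, map_sub] at h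
        simp only [hβ, node]
        rw [h]
        congr 2
        push_cast
        ring
    · intro q hq hq'
      have hq := Finset.mem_range.1 hq
      rcases lt_or_ge q p with h | h
      · rw [hZA q h, zero_mul]
      · rw [hzero q, mul_zero]
        by_contra h'
        exact hq' (Finset.mem_Icc.2 (by omega))

theorem sum_W {lam : YoungDiagram} {m p k : ℕ} (hp : lam.colLen 0 + p < m) :
    ∑ q ∈ Finset.range m, cst (W n lam p (l n lam + q)) *
      ∏ t ∈ Finset.range q, (node n (lam.colLen 0) k - node n (lam.colLen 0) t) =
    columnRow (lam.colLen 0) (node n (lam.colLen 0)) lam.colLen (lam.colLen 0 + p) k := by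
  have h0 := lam.colLen_anti 0 p (Nat.zero_le _)
  set L := lam.colLen 0 with hL
  set h := lam.colLen p with hh
  have hW : ∀ q, q ≤ L + p → W n lam p (l n lam + q) =
      (-1) ^ (L + p - q) * f n lam (L + p - q) p := by
    intro q hq
    have e : ((n : ℤ) + p + 1 - (l n lam + q)).toNat = L + p - q := by
      rw [l]
      omega
    rw [W, if_pos (by rw [l]; omega), e]
  have hW0 : ∀ q, L + p < q → W n lam p (l n lam + q) = 0 := by
    intro q hq
    rw [W, if_neg (by rw [l]; omega)]
  have hsub : Finset.Ico (L + p - h) (L + p + 1) ⊆ Finset.range m := fun q hq => by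
    have := Finset.mem_Ico.1 hq
    exact Finset.mem_range.2 (by omega)
  rw [← Finset.sum_subset hsub, Finset.sum_Ico_eq_sum_range,
    show L + p + 1 - (L + p - h) = h + 1 by omega, columnRow, Nat.add_sub_cancel_left, ← hh]
  · have key := neg_pow_eq_sum_complete
      (fun t => (ex (-a (pt n L (L + p - h + t))) : RTΔ n)) (ex (-a (pt n L k))) h
    have key' := congrArg (MvPowerSeries.C (σ := ℕ)) key
    rw [map_sum, map_pow] at key'
    have e1 : node n L k - 1 = MvPowerSeries.C (-ex (-a (pt n L k))) := by
      rw [node, b, cst, map_sub, map_one, map_neg]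
      ring
    rw [e1, ← key', Finset.sum_mul]
    refine Finset.sum_congr rfl fun c hc => ?_
    have hc := Finset.mem_range.1 hc
    rw [hW _ (by omega), show L + p - (L + p - h + c) = h - c by omega,
      f_eq_complete (by omega), Finset.prod_range_add, map_mul (MvPowerSeries.C (σ := ℕ)),
      map_prod]
    have e2 : ∀ t, node n L k - node n L (L + p - h + t) =
        MvPowerSeries.C (ex (-a (pt n L (L + p - h + t))) - ex (-a (pt n L k))) := by
      intro t
      rw [node, node, cst, cst, ← map_sub]
      congr 1
      rw [b, b]
      ring
    simp only [e2]
    ring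
  · intro q hq hq'
    rcases lt_or_ge (L + p) q with h1 | h1
    · rw [hW0 q h1, cst, map_zero, zero_mul]
    · have h2 : q < L + p - h := by
        by_contra h2
        exact hq' (Finset.mem_Ico.2 (by omega))
      rw [hW q h1, f_eq_zero (by omega), mul_zero, cst, map_zero, zero_mul]

theorem N_mul_newtonBasis {lam : YoungDiagram} (hlam : IsKSmall n lam) :
    N n lam * newtonBasis (lam.colLen 0 + lam.rowLen 0) (node n (lam.colLen 0)) =
      shapeMatrix (lam.colLen 0 + lam.rowLen 0) (lam.colLen 0) (nodeValue n (lam.colLen 0))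
        (node n (lam.colLen 0)) lam.colLen := by
  ext1 p k
  simp only [Matrix.mul_apply, N, newtonBasis, Matrix.of_apply, shapeMatrix, newtonMatrix]
  have hn := hlam.2
  split_ifs with hp
  · rw [← sum_ZA (by omega) k.2]
    exact Fin.sum_univ_eq_sum_range (fun q => ZA n (l n lam + (p : ℕ)) (l n lam + (q : ℕ)) *
      ∏ t ∈ Finset.range q, (node n (lam.colLen 0) k - node n (lam.colLen 0) t)) _
  · obtain ⟨p', hp'⟩ : ∃ p', (p : ℕ) = lam.colLen 0 + p' := ⟨p - lam.colLen 0, by omega⟩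
    have hlt := p.2
    rw [hp'] at hlt ⊢
    rw [← sum_W hlt, Nat.add_sub_cancel_left]
    exact Fin.sum_univ_eq_sum_range (fun q => cst (W n lam p' (l n lam + (q : ℕ))) *
      ∏ t ∈ Finset.range q, (node n (lam.colLen 0) k - node n (lam.colLen 0) t)) _

theorem columnProd_eq_ξ (n : ℕ) (lam : YoungDiagram) :
    columnProd n (lam.colLen 0) = (ξ n lam : Series n) := by
  rw [columnProd, ξ, Units.coe_prod, ← Finset.prod_range_reflect]
  refine Finset.prod_congr rfl fun t ht => ?_
  have ht := Finset.mem_range.1 ht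
  have e := shift_eq_pt (n := n) (r := 0) ht
  rw [Nat.cast_zero, zero_sub, zero_add] at e
  rw [e]

end Matrices

end KSchur

end

theorem mainTheorem5 (n : ℕ) (hn : 2 ≤ n) (lam : YoungDiagram) (hlam : KSchur.IsKSmall n lam) :
    KSchur.g n lam =
      KSchur.cst (KSchur.ex (KSchur.diagWeight n lam + KSchur.columnWeight n lam)) *
        ((KSchur.N n lam).det /ₚ KSchur.ξ n lam) := by
  have hV : IsUnit (KSchur.newtonBasis (lam.colLen 0 + lam.rowLen 0)
      (KSchur.node n (lam.colLen 0))).det :=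
    KSchur.isUnit_det_newtonBasis fun s t hs ht hst =>
      KSchur.isUnit_node_sub_node (hs.trans_le (by have := hlam.2; omega))
        (ht.trans_le (by have := hlam.2; omega)) hst
  have h := KSchur.invariant_g hlam
  unfold KSchur.Invariant at h
  rw [← KSchur.N_mul_newtonBasis hlam, Matrix.det_mul, KSchur.columnProd_eq_ξ] at h
  rw [KSchur.diagWeight_add_columnWeight, ← divp_assoc, eq_divp_iff_mul_eq]
  refine hV.mul_left_cancel ?_
  linear_combination h
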